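/- There is a polynomial $p$ with natural-number coefficients such that the following holds. Let $\Sigma$ be a finite alphabet and let $N_1, N_2$ be Petri nets over $\Sigma$ whose coverability languages are disjoint, $L(N_1)\cap L(N_2)=\emptyset$. Then there is a nondeterministic finite automaton $\mathcal{A}$ over $\Sigma$ with at most $$2^{2^{2^{p(|N_1|+|N_2|)}}}$$ states that separates $L(N_1)$ and $L(N_2)$, that is, $L(N_1)\subseteq L(\mathcal{A})$ and $L(\mathcal{A})\cap L(N_2)=\emptyset$. Here a Petri net over $\Sigma$ is a tuple $N=(P,T,F,\lambda,M_0,M_f)$ with disjoint finite sets $P$ of places and $T$ of transitions, a flow function $F:(P\cup T)\times(P\cup T)\to\mathbb{N}$, a labeling $\lambda:T\to\Sigma$, and an initial and a final marking $M_0,M_f\in\mathbb{N}^P$. A transition $t$ is enabled in a marking $M\in\mathbb{N}^P$ if $M(p)\ge F(p,t)$ for all $p\in P$; firing it then leads to the marking $M'$ with $M'(p)=M(p)-F(p,t)+F(t,p)$. The coverability language $L(N)$ is the set of words $\lambda(t_1)\cdots\lambda(t_k)$, $k\ge 0$, such that firing $t_1,\dots,t_k$ in this order from $M_0$ is possible and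 leads to a marking $M$ with $M(p)\ge M_f(p)$ for all $p\in P$. The size of a marking is $|M|=|P|\,(1+\lceil\log_2(1+\|M\|)\rceil)$ and the size of a net is $|N|=|P|\,|T|\,(1+\lceil\log_2(1+\|F\|)\rceil)+|M_0|+|M_f|$, where $\|\cdot\|$ denotes the maximum entry (and $0$ if there is none). -/

import Mathlib

/-- A labeled transition system over the alphabet `α` with (possibly infinitely many)
configurations in `S`. -/
structure LabeledTS (α S : Type*) where
  /-- `trans s a s'` means that there is an `a`-labeled transition from `s` to `s'`. -/
  trans : S → α → S → Prop
  /-- The initial configurations. -/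
  init : Set S
  /-- The final configurations. -/
  final : Set S

namespace LabeledTS

/-- `W.Path s w s'`: there is a path from `s` to `s'` over the word `w`. -/
inductive Path {α S : Type*} (W : LabeledTS α S) : S → List α → S → Prop
  | nil (s : S) : Path W s [] s
  | cons {s r s' : S} {a : α} {w : List α} :
      W.trans s a r → Path W r w s' → Path W s (a :: w) s'

/-- The words occurring on some path from an initial to a final configuration. -/
def language {α S : Type*} (W : LabeledTS α S) : Language α :=
  {w | ∃ i ∈ W.init, ∃ f ∈ W.final, W.Path i w f}

end LabeledTS

/-- A Petri net over the alphabet `α` with set of places `P` and set of transitions `T`.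
The disjoint union of places and transitions is `P ⊕ T`. -/
structure PetriNet (α P T : Type*) where
  /-- The flow function. -/
  flow : P ⊕ T → P ⊕ T → ℕ
  /-- The labeling of the transitions. -/
  label : T → α
  /-- The initial marking. -/
  initial : P → ℕ
  /-- The final marking, which has to be covered. -/
  final : P → ℕ

namespace PetriNet

/-- Transition `t` is enabled in marking `M`. -/
def Enabled {α P T : Type*} (N : PetriNet α P T) (M : P → ℕ) (t : T) : Prop :=
  ∀ p, N.flow (Sum.inl p) (Sum.inr t) ≤ M p

/-- `N.Fire M t M'`: transition `t` is enabled in `M`, and firing it leads to `M'`.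
The subtraction does not truncate, because `t` is enabled. -/
def Fire {α P T : Type*} (N : PetriNet α P T) (M : P → ℕ) (t : T) (M' : P → ℕ) : Prop :=
  N.Enabled M t ∧
    ∀ p, M' p = M p - N.flow (Sum.inl p) (Sum.inr t) + N.flow (Sum.inr t) (Sum.inl p)

/-- The transition system induced by a Petri net: its configurations are the markings, and the
final configurations are the markings that cover the final marking. -/
def toLabeledTS {α P T : Type*} (N : PetriNet α P T) : LabeledTS α (P → ℕ) where
  trans M a M' := ∃ t, N.Fire M t M' ∧ N.label t = a
  init := {N.initial}
  final := {M | N.final ≤ M}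

/-- The coverability language of a Petri net. -/
def language {α P T : Type*} (N : PetriNet α P T) : Language α :=
  N.toLabeledTS.language

/-- The infinity norm of a marking (`0` if there are no places). -/
def markingNorm {P : Type*} [Fintype P] (M : P → ℕ) : ℕ :=
  Finset.univ.sup M

/-- The infinity norm of the flow function. -/
def flowNorm {α P T : Type*} [Fintype P] [Fintype T] (N : PetriNet α P T) : ℕ :=
  Finset.univ.sup fun x => Finset.univ.sup fun y => N.flow x y

/-- The size `|P| (1 + ⌈log₂ (1 + ‖M‖)⌉)` of a marking; `Nat.clog 2` is `⌈log₂ ·⌉`. -/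
def markingSize {P : Type*} [Fintype P] (M : P → ℕ) : ℕ :=
  Fintype.card P * (1 + Nat.clog 2 (1 + markingNorm M))

/-- The size `|P| |T| (1 + ⌈log₂ (1 + ‖F‖)⌉) + |M₀| + |M_f|` of a Petri net, with all numbers
encoded in binary. -/
def size {α P T : Type*} [Fintype P] [Fintype T] (N : PetriNet α P T) : ℕ :=
  Fintype.card P * Fintype.card T * (1 + Nat.clog 2 (1 + N.flowNorm)) +
    markingSize N.initial + markingSize N.final

end PetriNet

/-- The language `R` separates `K` and `L`: it contains `K` and is disjoint from `L`. -/
def Language.Separates {α : Type*} (R K L : Language α) : Prop :=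
  K ≤ R ∧ Disjoint R L

/-! In the synchronized product of the nets, disjointness says that the joint final marking is not
coverable from the joint initial one. By Rackoff's argument (`CoverWithin.rackoff`) coverability has
witnesses of doubly exponential length, so it survives truncating all token counts at a doubly
exponential `B` (`CoverWithin.truncate`).

The separator runs on sets of truncated product markings: it guesses a transition of the first net,
follows all equally labeled ones of the second, and accepts if no marking in the set covers the
final marking of the second net. Along a covering run of the first net, all tracked markings stay
non-coverable, so the word is accepted (`separator_sound_left`). Whatever is guessed, a run of the
second net stays dominated by some tracked marking, so its words are rejected
(`separator_sound_right`). Passing to sets of truncated markings adds the third exponential. -/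

/-! ### Coverability and Rackoff's bound -/

section Coverability

variable {P T : Type*}

/-- `CoverWithin pre post target I n M`: from the marking `M` one can reach, by firing at most `n`
transitions, a marking that covers `target`, where only the places in `I` are looked at. -/
def CoverWithin (pre post : T → P → ℕ) (target : P → ℕ) (I : Finset P) : ℕ → (P → ℕ) → Prop
  | 0, M => ∀ p ∈ I, target p ≤ M p
  | n + 1, M => CoverWithin pre post target I n M ∨
      ∃ t, (∀ p ∈ I, pre t p ≤ M p) ∧
        CoverWithin pre post target I n fun p => M p - pre t p + post t p

variable {pre post : T → P → ℕ} {target : P → ℕ}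

theorem CoverWithin.mono_length {I : Finset P} {m n : ℕ} (hmn : m ≤ n) {M : P → ℕ}
    (h : CoverWithin pre post target I m M) : CoverWithin pre post target I n M := by
  induction hmn with
  | refl => exact h
  | step _ ih => exact Or.inl ih

/-- Coverability transfers to a marking in which each relevant place either has at least as many
tokens as before, or so many tokens that it cannot matter. -/
theorem CoverWithin.transfer {F G : ℕ} (hF : ∀ t p, pre t p ≤ F) (hG : ∀ p, target p ≤ G)
    {I J : Finset P} {n : ℕ} {M M' : P → ℕ}
    (hM : ∀ p ∈ J, (p ∈ I ∧ M p ≤ M' p) ∨ F * n + G ≤ M' p)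
    (h : CoverWithin pre post target I n M) : CoverWithin pre post target J n M' := by
  induction n generalizing M M' with
  | zero =>
    intro p hp
    rcases hM p hp with ⟨hI, hle⟩ | hle
    · exact (h p hI).trans hle
    · have := hG p
      omega
  | succ n ih =>
    rcases h with h | ⟨t, ht, h⟩
    · refine Or.inl (ih (fun p hp => (hM p hp).imp_right fun hle => ?_) h)
      rw [Nat.mul_succ] at hle
      omega
    · refine Or.inr ⟨t, fun p hp => ?_, ih (fun p hp => ?_) h⟩
      · rcases hM p hp with ⟨hI, hle⟩ | hle
        · exact (ht p hI).trans hle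
        · have := hF t p
          rw [Nat.mul_succ] at hle
          omega
      · rcases hM p hp with ⟨hI, hle⟩ | hle
        · exact Or.inl ⟨hI, by omega⟩
        · have := hF t p
          rw [Nat.mul_succ] at hle
          exact Or.inr (by omega)

theorem CoverWithin.mono_marking {I J : Finset P} (hJI : J ⊆ I) {n : ℕ} {M M' : P → ℕ}
    (hM : ∀ p ∈ J, M p ≤ M' p) (h : CoverWithin pre post target I n M) :
    CoverWithin pre post target J n M' := by
  induction n generalizing M M' with
  | zero => exact fun p hp => (h p (hJI hp)).trans (hM p hp)
  | succ n ih =>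
    rcases h with h | ⟨t, ht, h⟩
    · exact Or.inl (ih hM h)
    · exact Or.inr ⟨t, fun p hp => (ht p (hJI hp)).trans (hM p hp),
        ih (fun p hp => by have := hM p hp; omega) h⟩

/-- Rackoff's bound on the length of shortest covering sequences, for `d` places, transitions
consuming at most `F` tokens per place and a target with at most `G` tokens per place; the
recursion is on the number of places that are looked at. -/
def rackoffBound (F G d : ℕ) : ℕ → ℕ
  | 0 => 0
  | i + 1 => rackoffBound F G d i + (F * rackoffBound F G d i + G) ^ d

/-- Once some place in `I` holds `R = F * f + G` tokens, it can be forgotten: the rest is covered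
within `f` steps, which cannot exhaust it. Before that, the marking lies in a box with at most `R ^
d` elements. -/
theorem CoverWithin.rackoff [Fintype P] {F G : ℕ} (hF : ∀ t p, pre t p ≤ F)
    (hG : ∀ p, target p ≤ G) (i : ℕ) {I : Finset P} (hI : I.card = i) {n : ℕ} {M : P → ℕ}
    (h : CoverWithin pre post target I n M) :
    CoverWithin pre post target I (rackoffBound F G (Fintype.card P) i) M := by
  classical
  induction i generalizing I n M with
  | zero =>
    obtain rfl := Finset.card_eq_zero.mp hI
    exact fun p hp => absurd hp (Finset.notMem_empty p)
  | succ i ih =>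
    set f := rackoffBound F G (Fintype.card P) i with hf
    set R := F * f + G with hR
    -- Instead of excising repetitions from a run, count the box markings coverable within `n`
    -- steps. A box marking that needs exactly `n + 1` steps enlarges this set, which pays for its
    -- extra step.
    have key : ∀ n (M : P → ℕ), CoverWithin pre post target I n M →
        CoverWithin pre post target I
          (f + (Finset.univ.filter fun v : P → Fin R =>
            CoverWithin pre post target I n fun p => (v p : ℕ)).card) M := by
      intro n
      induction n with
      | zero => exact fun M h => h.mono_length (Nat.zero_le _)
      | succ n ihn =>
        intro M h
        by_cases hsmall : ∀ p ∈ I, M p < R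
        · have hsub : (Finset.univ.filter fun v : P → Fin R =>
                CoverWithin pre post target I n fun p => (v p : ℕ)) ⊆
              Finset.univ.filter fun v : P → Fin R =>
                CoverWithin pre post target I (n + 1) fun p => (v p : ℕ) := by
            intro v hv
            simp only [Finset.mem_filter, Finset.mem_univ, true_and] at hv ⊢
            exact Or.inl hv
          by_cases hn : CoverWithin pre post target I n M
          · exact (ihn M hn).mono_length (Nat.add_le_add_left (Finset.card_le_card hsub) _)
          obtain hn' | ⟨t, ht, hcov⟩ := h
          · exact absurd hn' hn
          have hne : I.Nonempty := Finset.card_pos.mp (by omega)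
          obtain ⟨p₀, hp₀⟩ := hne
          have hRpos : 0 < R := (Nat.zero_le _).trans_lt (hsmall p₀ hp₀)
          -- Places outside `I` are never inspected, so the value 0 there is arbitrary.
          let v : P → Fin R := fun p => if hp : p ∈ I then ⟨M p, hsmall p hp⟩ else ⟨0, hRpos⟩
          have hv : ∀ p ∈ I, (v p : ℕ) = M p := fun p hp => by simp [v, hp]
          have hlt : (Finset.univ.filter fun v : P → Fin R =>
                CoverWithin pre post target I n fun p => (v p : ℕ)).card <
              (Finset.univ.filter fun v : P → Fin R =>
                CoverWithin pre post target I (n + 1) fun p => (v p : ℕ)).card := by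
            refine Finset.card_lt_card (Finset.ssubset_iff_of_subset hsub |>.mpr ⟨v, ?_, ?_⟩)
            · simp only [Finset.mem_filter, Finset.mem_univ, true_and]
              exact CoverWithin.mono_marking (M := M) subset_rfl (fun p hp => (hv p hp).ge)
                (Or.inr ⟨t, ht, hcov⟩)
            · simp only [Finset.mem_filter, Finset.mem_univ, true_and]
              exact fun hc => hn (hc.mono_marking subset_rfl fun p hp => (hv p hp).le)
          have hnext : CoverWithin pre post target I (_ + 1) M := Or.inr ⟨t, ht, ihn _ hcov⟩
          exact hnext.mono_length (by omega)
        · push Not at hsmall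
          obtain ⟨p, hp, hRp⟩ := hsmall
          have herase : CoverWithin pre post target (I.erase p) (n + 1) M :=
            h.mono_marking (Finset.erase_subset p I) fun _ _ => le_rfl
          have hcard : (I.erase p).card = i := by rw [Finset.card_erase_of_mem hp, hI]; rfl
          have := CoverWithin.transfer hF hG (J := I) (M' := M) (fun q hq => ?_)
            (ih hcard herase)
          · exact this.mono_length (Nat.le_add_right _ _)
          · by_cases hqp : q = p
            · subst hqp
              exact Or.inr hRp
            · exact Or.inl ⟨Finset.mem_erase.mpr ⟨hqp, hq⟩, le_rfl⟩
    refine (key n M h).mono_length ?_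
    rw [rackoffBound]
    refine Nat.add_le_add_left ((Finset.card_le_univ _).trans_eq ?_) _
    simp [hR, hf]

/-- Any marking that covers the target still does so after truncation at a uniform bound. -/
theorem CoverWithin.truncate [Fintype P] {F G B : ℕ} (hF : ∀ t p, pre t p ≤ F)
    (hG : ∀ p, target p ≤ G)
    (hB : F * rackoffBound F G (Fintype.card P) (Fintype.card P) + G ≤ B) {n : ℕ} {M : P → ℕ}
    (h : CoverWithin pre post target Finset.univ n M) :
    ∃ k, CoverWithin pre post target Finset.univ k fun p => min B (M p) := by
  refine ⟨_, CoverWithin.transfer hF hG (fun p hp => ?_) (h.rackoff hF hG _ rfl)⟩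
  rw [Finset.card_univ]
  rcases le_total (M p) B with hle | hle
  · exact Or.inl ⟨hp, by rw [min_eq_right hle]⟩
  · exact Or.inr (by rwa [min_eq_left hle])

/-- With `x` the bound for `i`, the next one plus 1 is at most `(C * (x + 1)) ^ (d + 1)`, so each
place multiplies the exponent of `C` by at most `2 * (d + 1)`. -/
theorem rackoffBound_le {F G C d : ℕ} (hC : 2 ≤ C) (hFG : F + G ≤ C) (i : ℕ) :
    rackoffBound F G d i + 1 ≤ C ^ (2 * (d + 1)) ^ i := by
  induction i with
  | zero => simp only [rackoffBound]; simp; omega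
  | succ i ih =>
    set x := rackoffBound F G d i with hx
    set e := (2 * (d + 1)) ^ i with he
    have he1 : 1 ≤ e := Nat.one_le_pow _ _ (by omega)
    have hlin : F * x + G ≤ C * (x + 1) := by
      nlinarith [Nat.mul_le_mul_right (x + 1) hFG, Nat.zero_le (G * x)]
    have hpos : 1 ≤ (C * (x + 1)) ^ d := Nat.one_le_pow _ _ (by positivity)
    calc rackoffBound F G d (i + 1) + 1 = (x + 1) * 1 + (F * x + G) ^ d := by
          rw [rackoffBound]; ring
      _ ≤ (x + 1) * (C * (x + 1)) ^ d + (C * (x + 1)) ^ d * (x + 1) := by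
          refine Nat.add_le_add (Nat.mul_le_mul_left _ hpos) ?_
          exact (Nat.pow_le_pow_left hlin d).trans (Nat.le_mul_of_pos_right _ (by omega))
      _ = (C * (x + 1)) ^ d * (2 * (x + 1)) := by ring
      _ ≤ (C * (x + 1)) ^ d * (C * (x + 1)) :=
          Nat.mul_le_mul_left _ (Nat.mul_le_mul_right _ hC)
      _ = (C * (x + 1)) ^ (d + 1) := (pow_succ _ _).symm
      _ ≤ (C * C ^ e) ^ (d + 1) := Nat.pow_le_pow_left (Nat.mul_le_mul_left _ ih) _
      _ = C ^ ((e + 1) * (d + 1)) := by rw [← pow_succ', ← pow_mul]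
      _ ≤ C ^ (2 * (d + 1)) ^ (i + 1) := by
          refine Nat.pow_le_pow_right (by omega) ?_
          rw [pow_succ, ← he]
          nlinarith [Nat.mul_le_mul_right (d + 1) he1]

end Coverability

/-! ### Finite transition systems as automata -/

namespace LabeledTS

/-- A labeled transition system with finitely many configurations is a finite automaton. -/
theorem exists_nfa {α S : Type*} [Fintype S] (W : LabeledTS α S) :
    ∃ A : NFA α (Fin (Fintype.card S)), A.accepts = W.language := by
  let e := Fintype.equivFin S
  let A : NFA α (Fin (Fintype.card S)) :=
    { step := fun i a => {j | W.trans (e.symm i) a (e.symm j)}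
      start := {i | e.symm i ∈ W.init}
      accept := {i | e.symm i ∈ W.final} }
  have key : ∀ (w : List α) (s s' : S), e s' ∈ A.evalFrom {e s} w ↔ W.Path s w s' := by
    intro w
    induction w with
    | nil =>
      intro s s'
      simp only [NFA.evalFrom_nil, Set.mem_singleton_iff, EmbeddingLike.apply_eq_iff_eq]
      constructor
      · rintro rfl
        exact Path.nil _
      · rintro ⟨⟩
        rfl
    | cons a w ih =>
      intro s s'
      rw [NFA.evalFrom_cons, NFA.stepSet_singleton, NFA.mem_evalFrom_iff_exists]
      constructor
      · rintro ⟨j, hj, hs'⟩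
        obtain ⟨r, rfl⟩ := e.surjective j
        refine Path.cons ?_ ((ih r s').mp hs')
        simpa [A] using hj
      · rintro (_ | ⟨htrans, hpath⟩)
        exact ⟨e _, by simpa [A] using htrans, (ih _ s').mpr hpath⟩
  refine ⟨A, Set.ext fun w => ?_⟩
  change (∃ j ∈ A.accept, j ∈ A.evalFrom A.start w) ↔ ∃ i ∈ W.init, ∃ f ∈ W.final, W.Path i w f
  constructor
  · rintro ⟨j, hj, hjw⟩
    obtain ⟨i, hi, hij⟩ := NFA.mem_evalFrom_iff_exists.mp hjw
    refine ⟨e.symm i, hi, e.symm j, hj, (key w _ _).mp ?_⟩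
    simpa using hij
  · rintro ⟨i, hi, f, hf, hpath⟩
    refine ⟨e f, by simpa [A] using hf, NFA.mem_evalFrom_iff_exists.mpr ⟨e i, ?_, ?_⟩⟩
    · simpa [A] using hi
    · exact (key w _ _).mpr hpath

end LabeledTS

/-! ### Petri nets and what their size bounds -/

namespace PetriNet

variable {α P T P₁ T₁ P₂ T₂ : Type*}

/-- The number of tokens that a transition consumes from a place. -/
def pre (N : PetriNet α P T) (t : T) (p : P) : ℕ := N.flow (Sum.inl p) (Sum.inr t)

/-- The number of tokens that a transition produces on a place. -/
def post (N : PetriNet α P T) (t : T) (p : P) : ℕ := N.flow (Sum.inr t) (Sum.inl p)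

theorem fire_iff {N : PetriNet α P T} {M M' : P → ℕ} {t : T} :
    N.Fire M t M' ↔ (∀ p, N.pre t p ≤ M p) ∧ M' = fun p => M p - N.pre t p + N.post t p :=
  and_congr_right fun _ => funext_iff.symm

theorem disjoint_language_iff {K L : Language α} :
    Disjoint K L ↔ Disjoint (K : Set (List α)) (L : Set (List α)) := Iff.rfl

theorem pre_le [Fintype P] [Fintype T] (N : PetriNet α P T) (t : T) (p : P) :
    N.pre t p ≤ 2 ^ N.size := by
  have hle : N.pre t p ≤ N.flowNorm :=
    (Finset.le_sup (f := fun y => N.flow (Sum.inl p) y) (Finset.mem_univ (Sum.inr t))).trans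
      (Finset.le_sup (f := fun x => Finset.univ.sup fun y => N.flow x y)
        (Finset.mem_univ (Sum.inl p)))
  -- The given `p` and `t` keep the factor of the logarithm in the size from vanishing.
  have hpos : 0 < Fintype.card P * Fintype.card T :=
    Nat.mul_pos (Fintype.card_pos_iff.mpr ⟨p⟩) (Fintype.card_pos_iff.mpr ⟨t⟩)
  have hclog := Nat.le_pow_clog one_lt_two (1 + N.flowNorm)
  have hsize : Nat.clog 2 (1 + N.flowNorm) ≤ N.size := by
    have := Nat.le_mul_of_pos_left (1 + Nat.clog 2 (1 + N.flowNorm)) hpos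
    unfold size
    omega
  have := Nat.pow_le_pow_right two_pos hsize
  omega

theorem final_le [Fintype P] [Fintype T] (N : PetriNet α P T) (p : P) :
    N.final p ≤ 2 ^ N.size := by
  have hle : N.final p ≤ markingNorm N.final := Finset.le_sup (Finset.mem_univ p)
  have hclog := Nat.le_pow_clog one_lt_two (1 + markingNorm N.final)
  have hsize : Nat.clog 2 (1 + markingNorm N.final) ≤ N.size := by
    have := Nat.le_mul_of_pos_left (1 + Nat.clog 2 (1 + markingNorm N.final))
      (Fintype.card_pos_iff.mpr ⟨p⟩)
    unfold size markingSize
    omega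
  have := Nat.pow_le_pow_right two_pos hsize
  omega

theorem card_le_size [Fintype P] [Fintype T] (N : PetriNet α P T) : Fintype.card P ≤ N.size := by
  have := Nat.le_mul_of_pos_right (Fintype.card P)
    (Nat.add_pos_left one_pos (Nat.clog 2 (1 + markingNorm N.final)))
  unfold size markingSize
  omega

/-! ### The synchronized product and the separator -/

section Product

variable (N₁ : PetriNet α P₁ T₁) (N₂ : PetriNet α P₂ T₂)

/-- The tokens consumed by a transition of the synchronized product. -/
def prodPre (t : {t : T₁ × T₂ // N₁.label t.1 = N₂.label t.2}) : P₁ ⊕ P₂ → ℕ :=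
  Sum.elim (N₁.pre t.1.1) (N₂.pre t.1.2)

/-- The tokens produced by a transition of the synchronized product. -/
def prodPost (t : {t : T₁ × T₂ // N₁.label t.1 = N₂.label t.2}) : P₁ ⊕ P₂ → ℕ :=
  Sum.elim (N₁.post t.1.1) (N₂.post t.1.2)

/-- The markings of the synchronized product from which its final marking can be covered. -/
def ProdCoverable [Fintype P₁] [Fintype P₂] (M : P₁ ⊕ P₂ → ℕ) : Prop :=
  ∃ n, CoverWithin (N₁.prodPre N₂) (N₁.prodPost N₂) (Sum.elim N₁.final N₂.final) Finset.univ n M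

variable {N₁ N₂}

theorem ProdCoverable.exists_word [Fintype P₁] [Fintype P₂] {M : P₁ ⊕ P₂ → ℕ}
    (h : N₁.ProdCoverable N₂ M) :
    ∃ (w : List α) (M₁ : P₁ → ℕ) (M₂ : P₂ → ℕ),
      N₁.toLabeledTS.Path (M ∘ Sum.inl) w M₁ ∧ N₁.final ≤ M₁ ∧
        N₂.toLabeledTS.Path (M ∘ Sum.inr) w M₂ ∧ N₂.final ≤ M₂ := by
  obtain ⟨n, h⟩ := h
  induction n generalizing M with
  | zero =>
    exact ⟨[], _, _, .nil _, fun p => h (Sum.inl p) (Finset.mem_univ _), .nil _,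
      fun p => h (Sum.inr p) (Finset.mem_univ _)⟩
  | succ n ih =>
    rcases h with h | ⟨⟨⟨t₁, t₂⟩, hlabel⟩, ht, h⟩
    · exact ih h
    · obtain ⟨w, M₁, M₂, h₁, hM₁, h₂, hM₂⟩ := ih h
      refine ⟨N₁.label t₁ :: w, M₁, M₂, .cons ⟨t₁, fire_iff.mpr ⟨?_, rfl⟩, rfl⟩ h₁, hM₁,
        .cons ⟨t₂, fire_iff.mpr ⟨?_, rfl⟩, hlabel.symm⟩ h₂, hM₂⟩
      · exact fun p => ht (Sum.inl p) (Finset.mem_univ _)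
      · exact fun p => ht (Sum.inr p) (Finset.mem_univ _)

variable (N₁ N₂)

/-- Firing in the synchronized product, on markings truncated at `B`, where a place with `B`
tokens is regarded as having an inexhaustible supply of them. -/
def truncFire (B : ℕ) (t : {t : T₁ × T₂ // N₁.label t.1 = N₂.label t.2})
    (q : P₁ ⊕ P₂ → Fin (B + 1)) : P₁ ⊕ P₂ → Fin (B + 1) := fun p =>
  if (q p : ℕ) = B then q p
  else ⟨min B (q p - N₁.prodPre N₂ t p + N₁.prodPost N₂ t p), by omega⟩

/-- The truncation of the initial marking of the synchronized product. -/
def truncInitial (B : ℕ) : P₁ ⊕ P₂ → Fin (B + 1) := fun p =>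
  ⟨min B (Sum.elim N₁.initial N₂.initial p), by omega⟩

/-- The subset-style separator: its configurations are sets of truncated product markings. It
guesses the transitions of the first net and tracks all possible choices of the second net. -/
def separator (B : ℕ) : LabeledTS α (Set (P₁ ⊕ P₂ → Fin (B + 1))) where
  trans D a D' := ∃ t₁, N₁.label t₁ = a ∧ (∀ q ∈ D, ∀ p, N₁.pre t₁ p ≤ q (Sum.inl p)) ∧
    D' = {r | ∃ q ∈ D, ∃ (t₂ : T₂) (h : N₁.label t₁ = N₂.label t₂),
      (∀ p, N₂.pre t₂ p ≤ q (Sum.inr p)) ∧ r = N₁.truncFire N₂ B ⟨(t₁, t₂), h⟩ q}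
  init := {{N₁.truncInitial N₂ B}}
  final := {D | ∀ q ∈ D, ¬ ∀ p, N₂.final p ≤ q (Sum.inr p)}

variable {N₁ N₂} {B : ℕ}

/-- The invariant of both soundness proofs: the value `B` acts as infinity and is never left, and
any smaller value is not yet truncated. -/
theorem truncFire_bound {t : {t : T₁ × T₂ // N₁.label t.1 = N₂.label t.2}}
    {q : P₁ ⊕ P₂ → Fin (B + 1)} {p : P₁ ⊕ P₂} {m : ℕ} (h : (q p : ℕ) = B ∨ m ≤ q p) :
    (N₁.truncFire N₂ B t q p : ℕ) = B ∨
      m - N₁.prodPre N₂ t p + N₁.prodPost N₂ t p ≤ N₁.truncFire N₂ B t q p := by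
  unfold truncFire
  split_ifs with hq
  · exact Or.inl hq
  · dsimp only
    rcases h with h | h
    · exact absurd h hq
    · omega

/-- Truncated firing does not enter the coverable markings. -/
theorem ProdCoverable.of_truncFire [Fintype P₁] [Fintype P₂]
    (htrunc : ∀ M, N₁.ProdCoverable N₂ M → N₁.ProdCoverable N₂ fun p => min B (M p))
    {t : {t : T₁ × T₂ // N₁.label t.1 = N₂.label t.2}}
    {q : P₁ ⊕ P₂ → Fin (B + 1)} (ht : ∀ p, N₁.prodPre N₂ t p ≤ q p)
    (h : N₁.ProdCoverable N₂ fun p => N₁.truncFire N₂ B t q p) :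
    N₁.ProdCoverable N₂ fun p => q p := by
  -- Saturated places get the tokens that `t` will consume, so genuine firing from `M` dominates
  -- truncated firing from `q`, while `M` still truncates to `q`.
  set M : P₁ ⊕ P₂ → ℕ := fun p => if (q p : ℕ) = B then B + N₁.prodPre N₂ t p else q p with hM
  have hMq : (fun p => min B (M p)) = fun p => (q p : ℕ) := by
    funext p
    have := (q p).is_lt
    simp only [hM]
    split_ifs <;> omega
  rw [← hMq]
  refine htrunc M ?_
  obtain ⟨n, hn⟩ := h
  refine ⟨n + 1, Or.inr ⟨t, fun p _ => ?_, hn.mono_marking subset_rfl fun p _ => ?_⟩⟩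
  · have := ht p
    simp only [hM]
    split_ifs <;> omega
  · simp only [hM, truncFire]
    split_ifs with hq
    · omega
    · exact min_le_right _ _

/-- The separator guesses the transitions of the given run. At the end, a tracked marking covers the
final marking of the first net; being non-coverable, it misses that of the second. -/
theorem separator_sound_left [Fintype P₁] [Fintype P₂]
    (htrunc : ∀ M, N₁.ProdCoverable N₂ M → N₁.ProdCoverable N₂ fun p => min B (M p))
    (hpre₁ : ∀ t p, N₁.pre t p ≤ B) (hfinal : ∀ p, N₁.final p ≤ B)
    {M M' : P₁ → ℕ} {w : List α} (hpath : N₁.toLabeledTS.Path M w M') (hM' : N₁.final ≤ M')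
    {D : Set (P₁ ⊕ P₂ → Fin (B + 1))}
    (hD : ∀ q ∈ D, ∀ p, (q (Sum.inl p) : ℕ) = B ∨ M p ≤ q (Sum.inl p))
    (hcov : ∀ q ∈ D, ¬ N₁.ProdCoverable N₂ fun p => q p) :
    ∃ D' ∈ (N₁.separator N₂ B).final, (N₁.separator N₂ B).Path D w D' := by
  induction hpath generalizing D with
  | nil M =>
    refine ⟨D, fun q hq hq₂ => hcov q hq ⟨0, ?_⟩, .nil _⟩
    rintro (p | p) -
    · rcases hD q hq p with h | h
      · exact (hfinal p).trans_eq h.symm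
      · exact (hM' p).trans h
    · exact hq₂ p
  | @cons M R M' a w htrans _ ih =>
    obtain ⟨t₁, hfire, hlabel⟩ := htrans
    obtain ⟨hen, rfl⟩ := fire_iff.mp hfire
    have hen' : ∀ q ∈ D, ∀ p, N₁.pre t₁ p ≤ q (Sum.inl p) := fun q hq p => by
      rcases hD q hq p with h | h
      · exact (hpre₁ t₁ p).trans_eq h.symm
      · exact (hen p).trans h
    obtain ⟨D', hD', hpath'⟩ := ih hM' (D := {r | ∃ q ∈ D, ∃ (t₂ : T₂)
      (h : N₁.label t₁ = N₂.label t₂), (∀ p, N₂.pre t₂ p ≤ q (Sum.inr p)) ∧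
        r = N₁.truncFire N₂ B ⟨(t₁, t₂), h⟩ q})
      (by
        rintro _ ⟨q, hq, t₂, h, -, rfl⟩ p
        exact truncFire_bound (hD q hq p))
      (by
        rintro _ ⟨q, hq, t₂, h, hen₂, rfl⟩ hc
        refine hcov q hq (hc.of_truncFire htrunc ?_)
        rintro (p | p)
        · exact hen' q hq p
        · exact hen₂ p)
    exact ⟨D', hD', .cons ⟨t₁, hlabel, hen', rfl⟩ hpath'⟩

/-- Since all choices of the second net are tracked, one marking in the set follows the given run
and finally violates acceptance. -/
theorem separator_sound_right (hpre₂ : ∀ t p, N₂.pre t p ≤ B) (hfinal : ∀ p, N₂.final p ≤ B)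
    {M M' : P₂ → ℕ} {w : List α} (hpath : N₂.toLabeledTS.Path M w M') (hM' : N₂.final ≤ M')
    {D D' : Set (P₁ ⊕ P₂ → Fin (B + 1))} (hpath' : (N₁.separator N₂ B).Path D w D')
    (hD : ∃ q ∈ D, ∀ p, (q (Sum.inr p) : ℕ) = B ∨ M p ≤ q (Sum.inr p)) :
    D' ∉ (N₁.separator N₂ B).final := by
  induction hpath generalizing D with
  | nil M =>
    cases hpath'
    obtain ⟨q, hq, h⟩ := hD
    refine fun hf => hf q hq fun p => ?_
    rcases h p with h | h
    · exact (hfinal p).trans_eq h.symm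
    · exact (hM' p).trans h
  | cons htrans _ ih =>
    cases hpath' with
    | cons htrans' hpath' =>
      obtain ⟨t₂, hfire, hlabel⟩ := htrans
      obtain ⟨hen, rfl⟩ := fire_iff.mp hfire
      obtain ⟨t₁, hlabel₁, -, rfl⟩ := htrans'
      obtain ⟨q, hq, h⟩ := hD
      refine ih hM' hpath' ⟨_, ⟨q, hq, t₂, hlabel₁.trans hlabel.symm, fun p => ?_, rfl⟩,
        fun p => truncFire_bound (h p)⟩
      rcases h p with h | h
      · exact (hpre₂ t₂ p).trans_eq h.symm
      · exact (hen p).trans h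

theorem separator_separates [Fintype P₁] [Fintype P₂]
    (htrunc : ∀ M, N₁.ProdCoverable N₂ M → N₁.ProdCoverable N₂ fun p => min B (M p))
    (hpre₁ : ∀ t p, N₁.pre t p ≤ B) (hpre₂ : ∀ t p, N₂.pre t p ≤ B)
    (hfinal₁ : ∀ p, N₁.final p ≤ B) (hfinal₂ : ∀ p, N₂.final p ≤ B)
    (hdisj : Disjoint N₁.language N₂.language) :
    (N₁.separator N₂ B).language.Separates N₁.language N₂.language := by
  constructor
  · rintro w ⟨_, rfl, M', hM', hpath⟩
    obtain ⟨D', hD', hpath'⟩ := separator_sound_left htrunc hpre₁ hfinal₁ hpath hM'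
      (D := {N₁.truncInitial N₂ B})
      (by
        rintro _ rfl p
        simp only [truncInitial, Sum.elim_inl]
        omega)
      (by
        rintro _ rfl ⟨n, hn⟩
        -- Truncation only lowers a marking, so coverability lifts back to the true initial marking
        -- and yields a common word.
        have hc : N₁.ProdCoverable N₂ (Sum.elim N₁.initial N₂.initial) :=
          ⟨n, hn.mono_marking subset_rfl fun p _ => min_le_right _ _⟩
        obtain ⟨w, M₁, M₂, h₁, hM₁, h₂, hM₂⟩ := hc.exists_word
        exact Set.disjoint_left.mp (disjoint_language_iff.mp hdisj)
          ⟨_, rfl, M₁, hM₁, h₁⟩ ⟨_, rfl, M₂, hM₂, h₂⟩)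
    exact ⟨_, rfl, D', hD', hpath'⟩
  · refine disjoint_language_iff.mpr (Set.disjoint_left.mpr ?_)
    rintro w ⟨_, rfl, D', hD', hpath'⟩ ⟨_, rfl, M', hM', hpath⟩
    refine separator_sound_right hpre₂ hfinal₂ hpath hM' hpath' ⟨_, rfl, fun p => ?_⟩ hD'
    simp only [truncInitial, Sum.elim_inr]
    omega

end Product

end PetriNet

/-! ### Counting states -/

/-- The truncation bound is doubly exponential, so that there are doubly exponentially many
truncated markings. -/
theorem truncation_card_le {s d : ℕ} (hd : d ≤ s) :
    (2 ^ s * rackoffBound (2 ^ s) (2 ^ s) d d + 2 ^ s + 1) ^ d ≤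
      2 ^ 2 ^ (s + ((s + 1) * s + 2) + s) := by
  set x := rackoffBound (2 ^ s) (2 ^ s) d d with hx
  set e := (2 * (d + 1)) ^ d with he
  have hC : 2 ≤ 2 ^ (s + 1) := by
    rw [pow_succ]
    have := Nat.one_le_two_pow (n := s)
    omega
  have hxe : x + 1 ≤ (2 ^ (s + 1)) ^ e := rackoffBound_le hC (by rw [pow_succ]; omega) d
  have hbase : 2 ^ s * x + 2 ^ s + 1 ≤ 2 ^ ((s + 1) * (e + 2)) :=
    calc 2 ^ s * x + 2 ^ s + 1 = 2 ^ s * (x + 1) + 1 := by ring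
      _ ≤ 2 ^ (s + 1) * (x + 1) := by
          have : 0 < 2 ^ s * (x + 1) := by positivity
          rw [pow_succ, mul_right_comm]
          omega
      _ ≤ 2 ^ (s + 1) * (2 ^ (s + 1)) ^ e := Nat.mul_le_mul_left _ hxe
      _ = 2 ^ ((s + 1) * (e + 1)) := by rw [← pow_succ', ← pow_mul]
      _ ≤ 2 ^ ((s + 1) * (e + 2)) :=
          Nat.pow_le_pow_right two_pos (Nat.mul_le_mul_left _ (by omega))
  have hs : s + 1 ≤ 2 ^ s := Nat.lt_two_pow_self
  have he' : e ≤ 2 ^ ((s + 1) * s) :=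
    calc e ≤ (2 ^ (s + 1)) ^ d := Nat.pow_le_pow_left (by rw [pow_succ]; omega) d
      _ ≤ (2 ^ (s + 1)) ^ s := Nat.pow_le_pow_right (by omega) hd
      _ = 2 ^ ((s + 1) * s) := (pow_mul _ _ _).symm
  have he2 : e + 2 ≤ 2 ^ ((s + 1) * s + 2) := by
    have := Nat.one_le_two_pow (n := (s + 1) * s)
    rw [pow_add]
    omega
  calc (2 ^ s * x + 2 ^ s + 1) ^ d ≤ (2 ^ ((s + 1) * (e + 2))) ^ d := Nat.pow_le_pow_left hbase d
    _ = 2 ^ ((s + 1) * (e + 2) * d) := (pow_mul _ _ _).symm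
    _ ≤ 2 ^ 2 ^ (s + ((s + 1) * s + 2) + s) := by
        refine Nat.pow_le_pow_right two_pos ?_
        rw [pow_add, pow_add]
        -- The three summands of the exponent bound `s + 1`, `e + 2` and `d` in turn.
        exact Nat.mul_le_mul (Nat.mul_le_mul hs he2) (by omega)

theorem mainTheorem6 :
    ∃ p : Polynomial ℕ,
      ∀ (α : Type*) (P₁ : Type*) (T₁ : Type*) (P₂ : Type*) (T₂ : Type*)
        [Fintype α] [Fintype P₁] [Fintype T₁] [Fintype P₂] [Fintype T₂]
        (N₁ : PetriNet α P₁ T₁) (N₂ : PetriNet α P₂ T₂),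
        Disjoint N₁.language N₂.language →
          ∃ (m : ℕ) (A : NFA α (Fin m)),
            m ≤ 2 ^ 2 ^ 2 ^ p.eval (N₁.size + N₂.size) ∧
              A.accepts.Separates N₁.language N₂.language := by
  classical
  refine ⟨.X + ((.X + 1) * .X + 2) + .X, ?_⟩
  intro α P₁ T₁ P₂ T₂ _ _ _ _ _ N₁ N₂ hdisj
  set s := N₁.size + N₂.size with hs
  set d := Fintype.card (P₁ ⊕ P₂) with hd
  set B := 2 ^ s * rackoffBound (2 ^ s) (2 ^ s) d d + 2 ^ s with hB
  have hs₁ : 2 ^ N₁.size ≤ 2 ^ s := Nat.pow_le_pow_right two_pos (by omega)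
  have hs₂ : 2 ^ N₂.size ≤ 2 ^ s := Nat.pow_le_pow_right two_pos (by omega)
  have hsB : 2 ^ s ≤ B := Nat.le_add_left _ _
  have hds : d ≤ s := by
    rw [hd, Fintype.card_sum]
    exact Nat.add_le_add N₁.card_le_size N₂.card_le_size
  have htrunc : ∀ M, N₁.ProdCoverable N₂ M → N₁.ProdCoverable N₂ fun p => min B (M p) := by
    rintro M ⟨n, hn⟩
    refine hn.truncate (F := 2 ^ s) (G := 2 ^ s) ?_ ?_ le_rfl
    · rintro t (p | p)
      · exact (N₁.pre_le _ p).trans hs₁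
      · exact (N₂.pre_le _ p).trans hs₂
    · rintro (p | p)
      · exact (N₁.final_le p).trans hs₁
      · exact (N₂.final_le p).trans hs₂
  obtain ⟨A, hA⟩ := (N₁.separator N₂ B).exists_nfa
  refine ⟨_, A, ?_, ?_⟩
  · rw [Fintype.card_set, Fintype.card_fun, Fintype.card_fin]
    refine Nat.pow_le_pow_right two_pos ?_
    simp only [Polynomial.eval_add, Polynomial.eval_mul, Polynomial.eval_X, Polynomial.eval_one,
      Polynomial.eval_ofNat]
    exact truncation_card_le hds
  · rw [hA]
    exact PetriNet.separator_separates htrunc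
      (fun t p => ((N₁.pre_le t p).trans hs₁).trans hsB)
      (fun t p => ((N₂.pre_le t p).trans hs₂).trans hsB)
      (fun p => ((N₁.final_le p).trans hs₁).trans hsB)
      (fun p => ((N₂.final_le p).trans hs₂).trans hsB) hdisj
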